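/- Let $G$ be a plane triangulation, that is, a finite simple graph which is (isomorphic to) the graph of a simplicial $3$-polytope: there is a polytope $P\subset\mathbb{R}^3$ of dimension $3$, all of whose proper faces are simplices, such that the vertices and edges of $G$ are the $0$-dimensional and $1$-dimensional faces of $P$. (By Steinitz's theorem these are exactly the graphs on at least four vertices of plane triangulations.) For $X\subseteq V(G)$ let $\mathcal{E}(X,\overline X)$ be the set of edges of $G$ with one end in $X$ and the other in $\overline X = V(G)\setminus X$. An edge cut of $G$ is a set $\mathcal{E}(X,\overline X)$ with $X\neq\varnothing\neq\overline X$; it is minimum if it has the smallest cardinality among all edge cuts of $G$, and trivial if it is the set of all edges incident to some vertex of $G$. Then: 1. every nontrivial minimum edge cut of $G$ has at least six edges; moreover, every edge cut $\mathcal{E}(X,\overline X)$ with $|X|\ge 3$ and $|\overline X|\ge 3$ (minimum or not) has at least six edges; 2. the minimum degree of $G$ is at most five; 3. hence every minimum edge cut of $G$ is trivial. -/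

import Mathlib

namespace Polytope

/-- Euclidean 3-space. -/
abbrev R3 : Type := EuclideanSpace ℝ (Fin 3)

/-- The dimension of a set: the dimension of its affine hull. -/
noncomputable def dim (P : Set R3) : ℕ :=
  Module.finrank ℝ (affineSpan ℝ P).direction

/-- A 3-polytope: the convex hull of finitely many points, of dimension 3. -/
def Is3Polytope (P : Set R3) : Prop :=
  (∃ S : Set R3, S.Finite ∧ P = convexHull ℝ S) ∧ dim P = 3

/-- A proper face: the nonempty set of maximizers on `P` of a linear functional, other than `P`
itself. For a 3-polytope these are exactly the intersections of `P` with its supporting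
planes (the zero functional is what would give `P`). -/
def IsProperFace (P F : Set R3) : Prop :=
  IsExposed ℝ P F ∧ F.Nonempty ∧ F ≠ P

/-- A simplex: the convex hull of finitely many affinely independent points. -/
def IsSimplex (F : Set R3) : Prop :=
  ∃ T : Finset R3, AffineIndependent ℝ (fun t : T => (t : R3)) ∧ F = convexHull ℝ (T : Set R3)

/-- A simplicial 3-polytope: all its (proper) faces are simplices. -/
def IsSimplicial3Polytope (P : Set R3) : Prop :=
  Is3Polytope P ∧ ∀ F : Set R3, IsProperFace P F → IsSimplex F

/-- The graph of `P`. Its vertices are the points `x` such that `{x}` is a face. Its edges are the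
1-dimensional faces, which for a polytope are the segments between two distinct vertices
that are faces. -/
def graph (P : Set R3) : SimpleGraph (P.exposedPoints ℝ) where
  Adj x y := x ≠ y ∧ IsProperFace P (segment ℝ (x : R3) (y : R3))
  symm := ⟨fun x y h => ⟨h.1.symm, by rw [segment_symm]; exact h.2⟩⟩
  loopless := ⟨fun _ h => h.1 rfl⟩

end Polytope

/-- `G` is (the abstract graph underlying) a plane triangulation: it is the graph of a simplicial
3-polytope, up to relabelling of the vertices. -/
def IsPlaneTriangulation {V : Type*} (G : SimpleGraph V) : Prop :=
  ∃ P : Set Polytope.R3, Polytope.IsSimplicial3Polytope P ∧ Nonempty (G ≃g Polytope.graph P)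

namespace EdgeCut

/-- The set of edges of `G` with one end in `X` and the other in the complement of `X`. -/
def cut {V : Type*} (G : SimpleGraph V) (X : Set V) : Set (Sym2 V) :=
  {e | ∃ x ∈ X, ∃ y ∈ Xᶜ, G.Adj x y ∧ e = s(x, y)}

/-- An edge cut: the edges between the two parts of a partition into two nonempty parts. -/
def IsEdgeCut {V : Type*} (G : SimpleGraph V) (C : Set (Sym2 V)) : Prop :=
  ∃ X : Set V, X.Nonempty ∧ Xᶜ.Nonempty ∧ C = cut G X

/-- A minimum edge cut: an edge cut of smallest cardinality. -/
def IsMinimum {V : Type*} (G : SimpleGraph V) (C : Set (Sym2 V)) : Prop :=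
  IsEdgeCut G C ∧ ∀ D : Set (Sym2 V), IsEdgeCut G D → C.ncard ≤ D.ncard

/-- A trivial edge cut consists of all the edges incident to some vertex. -/
def IsTrivial {V : Type*} (G : SimpleGraph V) (C : Set (Sym2 V)) : Prop :=
  ∃ v : V, C = G.incidenceSet v

end EdgeCut

/-! The triangular faces control the cuts. Call an edge or a triangle crossing if it meets both `X`
and its complement. A crossing triangle has two crossing edges and an edge lies in two triangles, so
there are at least as many crossing edges as crossing triangles. If both sides have three vertices,
3-connectivity and a König argument give three disjoint crossing edges; two of them span four
vertices, so no triangle contains both, and their 3 · 2 triangles are distinct. Hence the bound six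
(`six_le_ncard_cut`).

A vertex has at most as many neighbours as triangles, so minimum degree six would force `6n ≤ 3 *
#T`; but `#T < 2n`. A cut around two vertices exceeds a degree, so a minimum cut must isolate one
vertex.

The geometry uses linear functionals only. Supporting planes are rotated until they hit a new
vertex, which yields the simplex method (`exists_improving`), the two triangles at an edge, and
3-connectivity by climbing as in Balinski's theorem (`exists_cross`). Instead of Euler's formula,
each triangle is charged to its middle vertex under a generic functional (`not_three_middle`). -/

section

open Finset Module

/-! ### Combinatorics of triangles and cuts. -/

/-- A family of triples of vertices that behaves like the set of facets of a simplicial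
3-polytope with graph `G`. -/
structure IsFacetFamily {V : Type*} [Fintype V] [DecidableEq V] (G : SimpleGraph V)
    (T : Finset (Finset V)) : Prop where
  card_eq : ∀ A ∈ T, #A = 3
  adj : ∀ A ∈ T, ∀ u ∈ A, ∀ v ∈ A, u ≠ v → G.Adj u v
  card_edge : ∀ u v, G.Adj u v → #{A ∈ T | u ∈ A ∧ v ∈ A} = 2
  -- Weaker than Euler's `2n - 4`, but enough for the minimum degree.
  card_lt : #T < 2 * Fintype.card V
  exists_neighbor : ∀ v, ∃ w, G.Adj v w
  exists_cross : ∀ (X : Set V) (a b : V), (∃ x ∈ X, x ≠ a ∧ x ≠ b) → (∃ y ∈ Xᶜ, y ≠ a ∧ y ≠ b) →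
    ∃ x ∈ X, ∃ y ∈ Xᶜ, G.Adj x y ∧ x ≠ a ∧ x ≠ b ∧ y ≠ a ∧ y ≠ b

/-- A relation that survives the deletion of any two elements contains a 3-matching. -/
theorem exists_three_matching {V : Type*} [Nonempty V] (R : V → V → Prop)
    (h : ∀ a b, ∃ x y, R x y ∧ x ≠ a ∧ x ≠ b ∧ y ≠ a ∧ y ≠ b) :
    ∃ x₁ y₁ x₂ y₂ x₃ y₃, R x₁ y₁ ∧ R x₂ y₂ ∧ R x₃ y₃ ∧ x₁ ≠ x₂ ∧ x₁ ≠ x₃ ∧ x₂ ≠ x₃ ∧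
      y₁ ≠ y₂ ∧ y₁ ≠ y₃ ∧ y₂ ≠ y₃ := by
  have key : ∀ x₁ y₁ x₂ y₂ x₃, R x₁ y₁ → R x₂ y₂ → R x₃ y₁ → x₁ ≠ x₂ → y₁ ≠ y₂ → x₃ ≠ x₁ →
      x₃ ≠ x₂ → ∃ x₁ y₁ x₂ y₂ x₃ y₃, R x₁ y₁ ∧ R x₂ y₂ ∧ R x₃ y₃ ∧ x₁ ≠ x₂ ∧ x₁ ≠ x₃ ∧
      x₂ ≠ x₃ ∧ y₁ ≠ y₂ ∧ y₁ ≠ y₃ ∧ y₂ ≠ y₃ := by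
    intro x₁ y₁ x₂ y₂ x₃ h₁ h₂ h₃ n₁₂ m₁₂ n₃₁ n₃₂
    obtain ⟨x, y₃, hx, -, -, hy1, hy2⟩ := h y₁ y₂
    by_cases e1 : x = x₂
    · subst e1
      -- `x` and `y₁` now cover all edges found so far, so these two are deleted; each of them has
      -- two known neighbours, one of which avoids the new edge.
      obtain ⟨x', y', hxy, hx2, -, -, hy1'⟩ := h x y₁
      have hx' : ∃ z, R z y₁ ∧ z ≠ x ∧ z ≠ x' := by
        by_cases e : x₁ = x'
        · exact ⟨x₃, h₃, n₃₂, e ▸ n₃₁⟩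
        · exact ⟨x₁, h₁, n₁₂, e⟩
      have hy' : ∃ z, R x z ∧ z ≠ y₁ ∧ z ≠ y' := by
        by_cases e : y₂ = y'
        · exact ⟨y₃, hx, hy1, e ▸ hy2⟩
        · exact ⟨y₂, h₂, m₁₂.symm, e⟩
      obtain ⟨z, hz, hz1, hz2⟩ := hx'
      obtain ⟨t, ht, ht1, ht2⟩ := hy'
      exact ⟨x', y', z, y₁, x, t, hxy, hz, ht, hz2.symm, hx2, hz1, hy1', ht2.symm, ht1.symm⟩
    · by_cases e2 : x = x₁
      · subst e2
        exact ⟨x, y₃, x₃, y₁, x₂, y₂, hx, h₃, h₂, n₃₁.symm, n₁₂, n₃₂, hy1, hy2, m₁₂⟩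
      · exact ⟨x₁, y₁, x₂, y₂, x, y₃, h₁, h₂, hx, n₁₂, Ne.symm e2, Ne.symm e1, m₁₂, hy1.symm,
          hy2.symm⟩
  obtain ⟨x₀⟩ := ‹Nonempty V›
  obtain ⟨x₁, y₁, h₁, -⟩ := h x₀ x₀
  obtain ⟨x₂, y₂, h₂, n1, -, -, n2⟩ := h x₁ y₁
  obtain ⟨x₃, y, h₃, n31, n32, -, -⟩ := h x₁ x₂
  by_cases e1 : y = y₁
  · subst e1
    exact key x₁ y x₂ y₂ x₃ h₁ h₂ h₃ n1.symm n2.symm n31 n32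
  · by_cases e2 : y = y₂
    · subst e2
      exact key x₂ y x₁ y₁ x₃ h₂ h₁ h₃ n1 n2 n32 n31
    · exact ⟨x₁, y₁, x₂, y₂, x₃, y, h₁, h₂, h₃, n1.symm, n31.symm, n32.symm, n2.symm,
        Ne.symm e1, Ne.symm e2⟩

namespace EdgeCut

variable {V : Type*} (G : SimpleGraph V)

theorem cut_compl (X : Set V) : cut G Xᶜ = cut G X := by
  ext e
  simp only [cut, compl_compl, Set.mem_ofPred_eq]
  constructor <;> rintro ⟨x, hx, y, hy, h, rfl⟩ <;> exact ⟨y, hy, x, hx, h.symm, Sym2.eq_swap⟩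

theorem cut_singleton (v : V) : cut G {v} = G.incidenceSet v := by
  ext e
  induction e with | _ a b
  simp only [cut, Set.mem_singleton_iff, exists_eq_left, Set.mem_compl_iff, Set.mem_ofPred_eq,
    SimpleGraph.mk'_mem_incidenceSet_iff]
  constructor
  · rintro ⟨y, hy, h, e⟩
    rcases Sym2.eq_iff.1 e with ⟨rfl, rfl⟩ | ⟨rfl, rfl⟩
    · exact ⟨h, Or.inl rfl⟩
    · exact ⟨h.symm, Or.inr rfl⟩
  · rintro ⟨h, rfl | rfl⟩
    · exact ⟨b, h.ne', h, rfl⟩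
    · exact ⟨a, h.ne, h.symm, Sym2.eq_swap⟩

theorem ncard_cut_singleton [Fintype V] [DecidableRel G.Adj] (v : V) :
    (cut G {v}).ncard = G.degree v := by
  classical
  rw [cut_singleton, ← Nat.card_coe_set_eq, Nat.card_eq_fintype_card,
    SimpleGraph.card_incidenceSet_eq_degree]

/-- A cut has as many edges as there are adjacent pairs directed from `X` to its complement. -/
theorem ncard_cut [Fintype V] [DecidableRel G.Adj] (X : Set V) [DecidablePred (· ∈ X)] :
    (cut G X).ncard = #{q : V × V | q.1 ∈ X ∧ q.2 ∉ X ∧ G.Adj q.1 q.2} := by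
  rw [← Set.ncard_coe_finset]
  symm
  refine Set.ncard_congr (fun q _ => s(q.1, q.2)) ?_ ?_ ?_
  · intro q hq
    simp only [coe_filter, mem_univ, true_and, Set.mem_ofPred_eq] at hq
    exact ⟨q.1, hq.1, q.2, hq.2.1, hq.2.2, rfl⟩
  · rintro ⟨a, b⟩ ⟨c, d⟩ h1 h2 e
    simp only [coe_filter, mem_univ, true_and, Set.mem_ofPred_eq] at h1 h2
    rcases Sym2.eq_iff.1 e with ⟨h, h'⟩ | ⟨h, h'⟩
    · exact Prod.ext h h'
    · exact absurd ((show a = d from h) ▸ h1.1) h2.2.1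
  · rintro e ⟨x, hx, y, hy, h, rfl⟩
    exact ⟨(x, y), by simpa using ⟨hx, hy, h⟩, rfl⟩

end EdgeCut

namespace IsFacetFamily

open EdgeCut

variable {V : Type*} [Fintype V] [DecidableEq V] {G : SimpleGraph V} [DecidableRel G.Adj]
  {T : Finset (Finset V)}

/-- Double counting: a neighbour of `v` lies in two triangles at `v`, and such a triangle has at
most two neighbours of `v`. -/
theorem degree_le (h : IsFacetFamily G T) (v : V) : G.degree v ≤ #{A ∈ T | v ∈ A} := by
  have := card_mul_le_card_mul (s := G.neighborFinset v) (t := {A ∈ T | v ∈ A})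
    (fun u A => u ∈ A) (m := 2) (n := 2) ?_ ?_
  · rw [SimpleGraph.card_neighborFinset_eq_degree] at this
    omega
  · intro u hu
    rw [SimpleGraph.mem_neighborFinset] at hu
    rw [← h.card_edge v u hu, bipartiteAbove, filter_filter]
  · intro A hA
    rw [mem_filter] at hA
    have h3 := h.card_eq A hA.1
    have : bipartiteBelow (fun u A => u ∈ A) (G.neighborFinset v) A ⊆ A.erase v := by
      intro u hu
      simp only [bipartiteBelow, mem_filter, SimpleGraph.mem_neighborFinset] at hu
      exact mem_erase.2 ⟨hu.1.ne', hu.2⟩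
    have := card_le_card this
    rw [card_erase_of_mem hA.2] at this
    omega

theorem minDegree_le_five (h : IsFacetFamily G T) : G.minDegree ≤ 5 := by
  by_contra! hc
  have h1 : ∑ v : V, 6 ≤ ∑ v, #{A ∈ T | v ∈ A} :=
    sum_le_sum fun v _ =>
      ((Nat.succ_le_of_lt hc).trans (G.minDegree_le_degree v)).trans (h.degree_le v)
  have h2 : ∑ v : V, #{A ∈ T | v ∈ A} = ∑ A ∈ T, #A := by
    have := sum_card_bipartiteAbove_eq_sum_card_bipartiteBelow (s := (univ : Finset V)) (t := T)
      (fun v A => v ∈ A)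
    simpa [bipartiteAbove, bipartiteBelow] using this
  rw [h2, sum_congr rfl h.card_eq] at h1
  have := h.card_lt
  simp at h1
  omega

/-- With only two neighbours, the two triangles on an edge at `v` would coincide. -/
theorem three_le_degree (h : IsFacetFamily G T) (v : V) : 3 ≤ G.degree v := by
  obtain ⟨u, hu⟩ := h.exists_neighbor v
  obtain ⟨A, B, hAB, e⟩ := card_eq_two.1 (h.card_edge v u hu)
  have hA : A ∈ ({A ∈ T | v ∈ A ∧ u ∈ A} : Finset _) := by simp [e]
  have hB : B ∈ ({A ∈ T | v ∈ A ∧ u ∈ A} : Finset _) := by simp [e]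
  rw [mem_filter] at hA hB
  have sub : ∀ C ∈ T, C.erase v ⊆ G.neighborFinset v ∨ v ∉ C := by
    intro C hC
    by_cases hv : v ∈ C
    · refine Or.inl fun w hw => ?_
      rw [mem_erase] at hw
      exact (G.mem_neighborFinset v w).2 (h.adj C hC v hv w hw.2 hw.1.symm)
    · exact Or.inr hv
  have hA' := (sub A hA.1).resolve_right (not_not.2 hA.2.1)
  have hB' := (sub B hB.1).resolve_right (not_not.2 hB.2.1)
  have cA : #(A.erase v) = 2 := by rw [card_erase_of_mem hA.2.1, h.card_eq A hA.1]
  have cB : #(B.erase v) = 2 := by rw [card_erase_of_mem hB.2.1, h.card_eq B hB.1]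
  rw [← SimpleGraph.card_neighborFinset_eq_degree]
  by_contra! hc
  have eA := eq_of_subset_of_card_le hA' (by omega)
  have eB := eq_of_subset_of_card_le hB' (by omega)
  exact hAB (by rw [← insert_erase hA.2.1, ← insert_erase hB.2.1, eA, eB])

theorem six_le_ncard_cut (h : IsFacetFamily G T) (X : Set V) (hX : 3 ≤ X.ncard)
    (hX' : 3 ≤ Xᶜ.ncard) : 6 ≤ (cut G X).ncard := by
  classical
  have avoid : ∀ (Y : Set V) (a b : V), 3 ≤ Y.ncard → ∃ y ∈ Y, y ≠ a ∧ y ≠ b := by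
    intro Y a b hY
    have : ({a, b} : Set V).ncard < Y.ncard := by
      have := Set.ncard_insert_le a {b}
      rw [Set.ncard_singleton] at this
      omega
    obtain ⟨y, hy, hy'⟩ := Set.exists_mem_notMem_of_ncard_lt_ncard this
    simp only [Set.mem_insert_iff, Set.mem_singleton_iff, not_or] at hy'
    exact ⟨y, hy, hy'⟩
  have : Nonempty V := (Set.nonempty_of_ncard_ne_zero (by omega : X.ncard ≠ 0)).to_subtype.map
    Subtype.val
  obtain ⟨x₁, y₁, x₂, y₂, x₃, y₃, h₁, h₂, h₃, n₁₂, n₁₃, n₂₃, m₁₂, m₁₃, m₂₃⟩ :=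
    exists_three_matching (fun x y => x ∈ X ∧ y ∉ X ∧ G.Adj x y) (fun a b => by
      obtain ⟨x, hx, y, hy, hxy, h⟩ := h.exists_cross X a b (avoid X a b hX) (avoid Xᶜ a b hX')
      exact ⟨x, y, ⟨hx, hy, hxy⟩, h⟩)
  set M : Finset (Finset V) := {A ∈ T | (∃ x ∈ A, x ∈ X) ∧ ∃ y ∈ A, y ∉ X} with hM
  set C : Finset (V × V) := {q : V × V | q.1 ∈ X ∧ q.2 ∉ X ∧ G.Adj q.1 q.2} with hC
  -- Incidences of crossing triangles with crossing edges: at least two per triangle, since its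
  -- third vertex lies on one of the sides, and at most two per edge.
  have hMC : #M * 2 ≤ #C * 2 := by
    refine card_mul_le_card_mul (fun A q => q.1 ∈ A ∧ q.2 ∈ A) ?_ ?_
    · intro A hA
      rw [hM, mem_filter] at hA
      obtain ⟨hA, ⟨x, hxA, hx⟩, y, hyA, hy⟩ := hA
      have hxy : x ≠ y := fun e => hy (e ▸ hx)
      obtain ⟨z, hz⟩ : ∃ z, z ∈ (A.erase x).erase y := by
        rw [← Finset.Nonempty, ← card_pos, card_erase_of_mem (mem_erase.2 ⟨hxy.symm, hyA⟩),
          card_erase_of_mem hxA, h.card_eq A hA]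
        norm_num
      simp only [mem_erase] at hz
      have mem : ∀ a b, a ∈ A → b ∈ A → a ∈ X → b ∉ X →
          (a, b) ∈ bipartiteAbove (fun A (q : V × V) => q.1 ∈ A ∧ q.2 ∈ A) C A := by
        intro a b ha hb haX hbX
        simp only [bipartiteAbove, hC, mem_filter, mem_univ, true_and]
        exact ⟨⟨haX, hbX, h.adj A hA a ha b hb fun e => hbX (e ▸ haX)⟩, ha, hb⟩
      by_cases hzX : z ∈ X
      · refine (one_lt_card.2 ⟨_, mem x y hxA hyA hx hy, _, mem z y hz.2.2 hyA hzX hy, ?_⟩)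
        simpa using hz.2.1.symm
      · refine (one_lt_card.2 ⟨_, mem x y hxA hyA hx hy, _, mem x z hxA hz.2.2 hx hzX, ?_⟩)
        simpa using hz.1.symm
    · rintro ⟨x, y⟩ hq
      simp only [hC, mem_filter, mem_univ, true_and] at hq
      rw [← h.card_edge x y hq.2.2]
      refine card_le_card fun A hA => ?_
      simp only [bipartiteBelow, hM, mem_filter] at hA ⊢
      exact ⟨hA.1.1, hA.2⟩
  have hM6 : 6 ≤ #M := by
    have disj : ∀ a b c d, a ∈ X ∧ b ∉ X ∧ G.Adj a b → c ∈ X ∧ d ∉ X ∧ G.Adj c d → a ≠ c → b ≠ d →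
        Disjoint {A ∈ T | a ∈ A ∧ b ∈ A} {A ∈ T | c ∈ A ∧ d ∈ A} := by
      intro a b c d hab hcd hac hbd
      rw [disjoint_left]
      intro A hA hA'
      rw [mem_filter] at hA hA'
      have ne : ∀ x y, x ∈ X → y ∉ X → x ≠ y := fun x y hx hy e => hy (e ▸ hx)
      have : #({a, b, c, d} : Finset V) = 4 := by
        rw [card_insert_of_notMem, card_insert_of_notMem, card_insert_of_notMem, card_singleton]
        · simpa using ne c d hcd.1 hcd.2.1
        · simpa using ⟨(ne c b hcd.1 hab.2.1).symm, hbd⟩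
        · simpa using ⟨hab.2.2.ne, hac, ne a d hab.1 hcd.2.1⟩
      have hsub : ({a, b, c, d} : Finset V) ⊆ A := by
        intro x
        simp only [mem_insert, mem_singleton]
        rintro (rfl | rfl | rfl | rfl)
        exacts [hA.2.1, hA.2.2, hA'.2.1, hA'.2.2]
      have := card_le_card hsub
      have := h.card_eq A hA.1
      omega
    have sub : ∀ a b, a ∈ X ∧ b ∉ X ∧ G.Adj a b → ({A ∈ T | a ∈ A ∧ b ∈ A} : Finset _) ⊆ M := by
      intro a b hab A hA
      rw [mem_filter] at hA
      rw [hM, mem_filter]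
      exact ⟨hA.1, ⟨a, hA.2.1, hab.1⟩, b, hA.2.2, hab.2.1⟩
    have := card_le_card (union_subset (union_subset (sub _ _ h₁) (sub _ _ h₂)) (sub _ _ h₃))
    rwa [card_union_of_disjoint, card_union_of_disjoint (disj _ _ _ _ h₁ h₂ n₁₂ m₁₂),
      h.card_edge _ _ h₁.2.2, h.card_edge _ _ h₂.2.2, h.card_edge _ _ h₃.2.2] at this
    exact disjoint_union_left.2 ⟨disj _ _ _ _ h₁ h₃ n₁₃ m₁₃, disj _ _ _ _ h₂ h₃ n₂₃ m₂₃⟩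
  have : (cut G X).ncard = #C := ncard_cut G X
  omega

omit [DecidableRel G.Adj] in
theorem isEdgeCut_singleton (h : IsFacetFamily G T) (v : V) : IsEdgeCut G (cut G {v}) := by
  obtain ⟨w, hw⟩ := h.exists_neighbor v
  exact ⟨{v}, Set.singleton_nonempty v, ⟨w, hw.ne'⟩, rfl⟩

/-- Apart from a possible edge `uv`, all edges at `u` and `v` are cut: at least `(deg u - 1) + (deg
v - 1)`, where `deg v ≥ 3`. -/
theorem degree_lt_ncard_cut_pair (h : IsFacetFamily G T) {u v : V} (huv : u ≠ v) :
    G.degree u < (cut G {u, v}).ncard := by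
  classical
  have hsub : ∀ a b, a ≠ b → (fun c => (a, c)) '' ((G.neighborFinset a).erase b : Set V) ⊆
      {q : V × V | q.1 ∈ ({a, b} : Set V) ∧ q.2 ∉ ({a, b} : Set V) ∧ G.Adj q.1 q.2} := by
    rintro a b hab _ ⟨c, hc, rfl⟩
    simp only [coe_erase, Set.mem_sdiff, mem_coe, SimpleGraph.mem_neighborFinset,
      Set.mem_singleton_iff] at hc
    simpa using ⟨⟨hc.1.ne', hc.2⟩, hc.1⟩
  have h1 : ((G.neighborFinset u).erase v).image (fun c => (u, c)) ∪
      ((G.neighborFinset v).erase u).image (fun c => (v, c)) ⊆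
      ({q : V × V | q.1 ∈ ({u, v} : Set V) ∧ q.2 ∉ ({u, v} : Set V) ∧ G.Adj q.1 q.2} :
        Finset (V × V)) := by
    rw [← coe_subset, coe_union, coe_image, coe_image, coe_filter]
    simp only [mem_univ, true_and]
    refine Set.union_subset (hsub u v huv) ?_
    rw [Set.pair_comm u v]
    exact hsub v u huv.symm
  have h2 := card_le_card h1
  rw [card_union_of_disjoint, card_image_of_injective _ (Prod.mk_right_injective u),
    card_image_of_injective _ (Prod.mk_right_injective v)] at h2
  · have h3 := pred_card_le_card_erase (s := G.neighborFinset u) (a := v)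
    have h4 := pred_card_le_card_erase (s := G.neighborFinset v) (a := u)
    rw [SimpleGraph.card_neighborFinset_eq_degree] at h3 h4
    have := h.three_le_degree u
    have := h.three_le_degree v
    rw [ncard_cut]
    omega
  · rw [disjoint_left]
    intro q hq hq'
    obtain ⟨c, -, rfl⟩ := mem_image.1 hq
    obtain ⟨d, -, e⟩ := mem_image.1 hq'
    exact huv (congrArg Prod.fst e).symm

theorem isTrivial_of_isMinimum (h : IsFacetFamily G T) {C : Set (Sym2 V)} (hC : IsMinimum G C) :
    IsTrivial G C := by
  obtain ⟨⟨X, hX, hX', rfl⟩, hmin⟩ := hC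
  have hmin' : ∀ v, (cut G X).ncard ≤ G.degree v := fun v =>
    (hmin _ (h.isEdgeCut_singleton v)).trans_eq (ncard_cut_singleton G v)
  have small : ∀ Y : Set V, Y.Nonempty → cut G Y = cut G X → Y.ncard < 3 →
      IsTrivial G (cut G X) := by
    intro Y hY e hlt
    have hpos := (Set.ncard_pos).2 hY
    obtain h1 | h2 : Y.ncard = 1 ∨ Y.ncard = 2 := by omega
    · obtain ⟨v, rfl⟩ := Set.ncard_eq_one.1 h1
      exact ⟨v, by rw [← e, cut_singleton]⟩
    · obtain ⟨u, v, huv, rfl⟩ := Set.ncard_eq_two.1 h2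
      have := h.degree_lt_ncard_cut_pair huv
      rw [e] at this
      exact absurd (hmin' u) this.not_ge
  rcases lt_or_ge X.ncard 3 with h1 | h1
  · exact small X hX rfl h1
  rcases lt_or_ge Xᶜ.ncard 3 with h2 | h2
  · exact small Xᶜ hX' (cut_compl G X) h2
  have : Nonempty V := hX.to_subtype.map Subtype.val
  obtain ⟨v, hv⟩ := G.exists_minimal_degree_vertex
  have := h.six_le_ncard_cut X h1 h2
  have := h.minDegree_le_five
  have := hmin' v
  omega

end IsFacetFamily

/-! ### Linear functionals in dimension three. -/

section LinearAlgebra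

variable {E : Type*} [AddCommGroup E] [Module ℝ E]

theorem AffineIndependent.exists_dual_sub_eq {ι : Type*} {q : ι → E} (hq : AffineIndependent ℝ q)
    (i₀ : ι) (c : ι → ℝ) : ∃ h : Dual ℝ E, ∀ i, h (q i - q i₀) = c i - c i₀ := by
  have hli := (affineIndependent_iff_linearIndependent_vsub ℝ q i₀).1 hq
  obtain ⟨h, hh⟩ := LinearMap.exists_extend
    ((Finsupp.linearCombination ℝ fun i : {x // x ≠ i₀} => c i - c i₀) ∘ₗ hli.repr)
  refine ⟨h, fun i => ?_⟩
  by_cases hi : i = i₀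
  · simp [hi]
  · have := LinearMap.congr_fun hh ⟨q i - q i₀, Submodule.subset_span ⟨⟨i, hi⟩, rfl⟩⟩
    simp only [LinearMap.comp_apply, Submodule.subtype_apply] at this
    rw [this, hli.repr_eq_single ⟨i, hi⟩ _ rfl]
    simp

theorem exists_dual_apply_eq_zero_notMem_span [Module.Finite ℝ E] (hE : finrank ℝ E = 3) (d : E)
    (g : Dual ℝ E) : ∃ h : Dual ℝ E, h d = 0 ∧ h ∉ Submodule.span ℝ {g} := by
  by_contra! hc
  have hle : LinearMap.ker (Dual.eval ℝ E d) ≤ Submodule.span ℝ {g} := fun h hh => hc h hh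
  have h1 := Submodule.finrank_mono hle
  have h2 := finrank_span_le_card (R := ℝ) ({g} : Set (Dual ℝ E))
  have h3 := LinearMap.finrank_range_add_finrank_ker (Dual.eval ℝ E d)
  have h4 := Submodule.finrank_le (LinearMap.range (Dual.eval ℝ E d))
  rw [Subspace.dual_finrank_eq, hE] at h3
  simp at h2 h4
  omega

theorem exists_dual_ne_zero_apply_eq_zero [Module.Finite ℝ E] (hE : finrank ℝ E = 3) (d e : E) :
    ∃ h : Dual ℝ E, h ≠ 0 ∧ h d = 0 ∧ h e = 0 := by
  have := LinearMap.ker_ne_bot_of_finrank_lt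
    (f := (Dual.eval ℝ E d).prod (Dual.eval ℝ E e)) (by
      rw [Subspace.dual_finrank_eq, hE]; simp)
  obtain ⟨h, hh, h0⟩ := Submodule.exists_mem_ne_zero_of_ne_bot this
  refine ⟨h, h0, ?_⟩
  simpa using hh

/-- Three vectors cannot be dependent modulo a common zero of three functionals of which each
vanishes on one of the vectors and is negative on the two others. -/
theorem eq_zero_of_sum_eq_of_neg (l : Fin 3 → Dual ℝ E) (r : Fin 3 → E) (z : E)
    (hz : ∀ i, l i z = 0) (hr : ∀ i, l i (r i) = 0) (hneg : ∀ i j, i ≠ j → l i (r j) < 0)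
    (c : Fin 3 → ℝ) (hc : ∑ i, c i • r i = z) : c = 0 := by
  have h0 := congrArg (l 0) hc
  have h1 := congrArg (l 1) hc
  have h2 := congrArg (l 2) hc
  simp only [Fin.sum_univ_three, map_add, map_smul, smul_eq_mul, hz, hr] at h0 h1 h2
  have n01 := hneg 0 1 (by decide)
  have n02 := hneg 0 2 (by decide)
  have n10 := hneg 1 0 (by decide)
  have n12 := hneg 1 2 (by decide)
  have n20 := hneg 2 0 (by decide)
  have n21 := hneg 2 1 (by decide)
  -- Each `l i` forces the other two coefficients to have opposite signs; three nonzero reals cannot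
  -- be pairwise of opposite sign.
  have key : ∀ a b m n : ℝ, m < 0 → n < 0 → a * m + b * n = 0 → 0 < a → b < 0 := by
    intro a b m n hm hn h ha
    nlinarith [mul_neg_of_pos_of_neg ha hm]
  have key' : ∀ a b m n : ℝ, m < 0 → n < 0 → a * m + b * n = 0 → a < 0 → 0 < b := by
    intro a b m n hm hn h ha
    nlinarith [mul_pos_of_neg_of_neg ha hm]
  have e0 : c 1 * l 0 (r 1) + c 2 * l 0 (r 2) = 0 := by linarith
  have e1 : c 0 * l 1 (r 0) + c 2 * l 1 (r 2) = 0 := by linarith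
  have e2 : c 0 * l 2 (r 0) + c 1 * l 2 (r 1) = 0 := by linarith
  have c0 : c 0 = 0 := by
    rcases lt_trichotomy (c 0) 0 with h | h | h
    · have p1 := key' _ _ _ _ n20 n21 e2 h
      have p2 := key' _ _ _ _ n10 n12 e1 h
      exact absurd (key _ _ _ _ n01 n02 e0 p1) p2.not_gt
    · exact h
    · have p1 := key _ _ _ _ n20 n21 e2 h
      have p2 := key _ _ _ _ n10 n12 e1 h
      exact absurd (key' _ _ _ _ n01 n02 e0 p1) p2.not_gt
  rw [c0, zero_mul, zero_add] at e1 e2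
  ext i
  fin_cases i
  · exact c0
  · exact (mul_eq_zero.1 e2).resolve_right n21.ne
  · exact (mul_eq_zero.1 e1).resolve_right n12.ne

end LinearAlgebra

/-! ### Edges and triangles of a simplicial point family. -/

/-- A finite family of points in 3-space, in convex position and spanning, such that the points
on any supporting plane are affinely independent: the vertices of a simplicial 3-polytope. -/
structure IsSimplicialFamily {V E : Type*} [AddCommGroup E] [Module ℝ E] (p : V → E) : Prop where
  finrank_eq : finrank ℝ E = 3
  exposed : ∀ v, ∃ l : Dual ℝ E, ∀ w, w ≠ v → l (p w) < l (p v)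
  spanning : ∀ l : Dual ℝ E, (∀ v w, l (p v) = l (p w)) → l = 0
  indep : ∀ l : Dual ℝ E, l ≠ 0 →
    AffineIndependent ℝ (fun v : {v // ∀ w, l (p w) ≤ l (p v)} => p v)

/-- The points on a supporting plane. -/
def IsFaceSet {V E : Type*} [AddCommGroup E] [Module ℝ E] (p : V → E) (A : Finset V) : Prop :=
  ∃ l : Dual ℝ E, l ≠ 0 ∧ ∀ v, v ∈ A ↔ ∀ w, l (p w) ≤ l (p v)

namespace IsSimplicialFamily

variable {V E : Type*} [Fintype V] [DecidableEq V] [AddCommGroup E] [Module ℝ E] {p : V → E}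

omit [Fintype V] [DecidableEq V] in
theorem finite_module (hp : IsSimplicialFamily p) : Module.Finite ℝ E :=
  Module.finite_of_finrank_eq_succ hp.finrank_eq

omit [Fintype V] [DecidableEq V] in
theorem injective (hp : IsSimplicialFamily p) : Function.Injective p := by
  intro v w h
  by_contra hne
  obtain ⟨l, hl⟩ := hp.exposed v
  exact (hl w (Ne.symm hne)).ne (by rw [h])

/-- Affine independence allows a functional `h` that is larger on `B` than on the rest of `A`;
tilting the supporting plane of `A` slightly by `h` leaves only `B` on it. -/
theorem isFaceSet_subset (hp : IsSimplicialFamily p) {A B : Finset V} (hA : IsFaceSet p A)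
    (hBA : B ⊆ A) (hB : B.Nonempty) : IsFaceSet p B := by
  obtain ⟨l, hl0, hl⟩ := hA
  obtain ⟨b, hb⟩ := hB
  have hbA := (hl b).1 (hBA hb)
  obtain ⟨h, hh⟩ := (hp.indep l hl0).exists_dual_sub_eq ⟨b, hbA⟩
    (fun v => if (v : V) ∈ B then 0 else -1)
  have hh' : ∀ v ∈ A, h (p v) = h (p b) + if v ∈ B then 0 else -1 := by
    intro v hv
    have := hh ⟨v, (hl v).1 hv⟩
    simp only [map_sub, if_pos hb] at this
    linarith
  -- For large `N` the tilt `N • l + h` is dominated by `l` off `A`.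
  have hN : ∃ N : ℝ, ∀ w, w ∉ A → N * l (p w) + h (p w) < N * l (p b) + h (p b) := by
    have : ∀ᶠ N : ℝ in Filter.atTop, ∀ w, w ∉ A →
        N * l (p w) + h (p w) < N * l (p b) + h (p b) := by
      rw [Filter.eventually_all]
      intro w
      by_cases hw : w ∈ A
      · simp [hw]
      · have hlt : l (p w) < l (p b) := by
          rw [hl] at hw
          push Not at hw
          obtain ⟨w', hw'⟩ := hw
          exact hw'.trans_le (hbA w')
        filter_upwards [Filter.eventually_gt_atTop ((h (p w) - h (p b)) / (l (p b) - l (p w)))]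
          with N hN _
        rw [div_lt_iff₀ (by linarith)] at hN
        linarith
    exact this.exists
  obtain ⟨N, hN⟩ := hN
  have hlA : ∀ v ∈ A, l (p v) = l (p b) := fun v hv => le_antisymm (hbA v) ((hl v).1 hv b)
  have hval : ∀ v ∈ B, (N • l + h) (p v) = (N • l + h) (p b) := by
    intro v hv
    simp [hlA v (hBA hv), hh' v (hBA hv), hv]
  have hlt : ∀ v ∉ B, (N • l + h) (p v) < (N • l + h) (p b) := by
    intro v hv
    by_cases hvA : v ∈ A
    · simp [hlA v hvA, hh' v hvA, hv]
    · simpa using hN v hvA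
  refine ⟨N • l + h, fun h0 => hl0 (hp.spanning l fun v w => ?_), fun v => ⟨fun hv w => ?_, ?_⟩⟩
  · have : ∀ v, v ∈ A := fun v => hBA (by
      by_contra hv
      simpa [h0] using hlt v hv)
    rw [hlA v (this v), hlA w (this w)]
  · rw [hval v hv]
    by_cases hw : w ∈ B
    · exact (hval w hw).le
    · exact (hlt w hw).le
  · intro hv
    by_contra hvB
    exact (hv b).not_gt (hlt v hvB)

/-- Every subset of the points on a supporting plane is the set of points on another one. -/
theorem isFaceSet_of_forall_le (hp : IsSimplicialFamily p) {l : Dual ℝ E} (hl : l ≠ 0)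
    {B : Finset V} (hB : B.Nonempty) (h : ∀ v ∈ B, ∀ w, l (p w) ≤ l (p v)) : IsFaceSet p B := by
  classical
  refine hp.isFaceSet_subset (A := {v | ∀ w, l (p w) ≤ l (p v)}) ⟨l, hl, by simp⟩ (fun v hv => ?_) hB
  simpa using h v hv

omit [DecidableEq V] in
/-- Rotating a supporting plane about the points it contains until it hits another point. -/
theorem exists_max_slope (v₀ : V) (g f : Dual ℝ E) (hg : ∃ w, g (p w) < g (p v₀)) :
    ∃ w₀ s, g (p w₀) < g (p v₀) ∧ f (p w₀) - f (p v₀) = s * (g (p v₀) - g (p w₀)) ∧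
      ∀ w, g (p w) < g (p v₀) → f (p w) - f (p v₀) ≤ s * (g (p v₀) - g (p w)) := by
  classical
  obtain ⟨w₀, hw₀, hmax⟩ := exists_max_image ({w | g (p w) < g (p v₀)} : Finset V)
    (fun w => (f (p w) - f (p v₀)) / (g (p v₀) - g (p w))) (by
      obtain ⟨w, hw⟩ := hg
      exact ⟨w, by simpa using hw⟩)
  simp only [mem_filter, mem_univ, true_and] at hw₀ hmax
  refine ⟨w₀, _, hw₀, (div_mul_cancel₀ _ (sub_pos.2 hw₀).ne').symm, fun w hw => ?_⟩
  exact (div_le_iff₀ (sub_pos.2 hw)).1 (hmax w hw)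

omit [Fintype V] [DecidableEq V] in
theorem exists_ne_apply (hp : IsSimplicialFamily p) {l : Dual ℝ E} (hl : l ≠ 0) (v : V) :
    ∃ w, l (p w) ≠ l (p v) := by
  by_contra! h
  exact hl (hp.spanning l fun a b => (h a).trans (h b).symm)

/-- The simplex method: a point that does not maximize `f` has a better neighbour. -/
theorem exists_improving (hp : IsSimplicialFamily p) (f : Dual ℝ E) (v : V)
    (hf : ∃ w, f (p v) < f (p w)) : ∃ w, f (p v) < f (p w) ∧ IsFaceSet p {v, w} := by
  have := hp.finite_module
  obtain ⟨w₁, hw₁⟩ := hf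
  have hne : w₁ ≠ v := by rintro rfl; exact lt_irrefl _ hw₁
  obtain ⟨g, hg⟩ := hp.exposed v
  have key : ∀ h : Dual ℝ E, ∃ w s, w ≠ v ∧ h (p w) - h (p v) = s * (g (p v) - g (p w)) ∧
      (∀ w, w ≠ v → h (p w) - h (p v) ≤ s * (g (p v) - g (p w))) ∧
      (h + s • g ≠ 0 → IsFaceSet p {v, w}) := by
    intro h
    obtain ⟨w₀, s, h1, h2, h3⟩ := exists_max_slope (p := p) v g h ⟨w₁, hg _ hne⟩
    refine ⟨w₀, s, ?_, h2, fun w hw => h3 w (hg w hw), fun h0 => ?_⟩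
    · rintro rfl
      exact lt_irrefl _ h1
    · have hle : ∀ w, (h + s • g) (p w) ≤ (h + s • g) (p v) := by
        intro w
        by_cases hw : w = v
        · rw [hw]
        · have := h3 w (hg w hw)
          simp only [LinearMap.add_apply, LinearMap.smul_apply, smul_eq_mul]
          linarith
      refine hp.isFaceSet_of_forall_le h0 (by simp) fun u hu => ?_
      rw [mem_insert, mem_singleton] at hu
      rcases hu with rfl | rfl
      · exact hle
      · intro w
        refine (hle w).trans_eq ?_
        simp only [LinearMap.add_apply, LinearMap.smul_apply, smul_eq_mul]
        linarith
  obtain ⟨w, s, hw, h1, h2, h3⟩ := key f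
  have hs : 0 < s := by
    have := h2 w₁ hne
    have := hg w₁ hne
    by_contra! hs
    nlinarith
  -- In this degenerate case `f` is a negative multiple of `g`, so every other point improves on `v`
  -- and any edge at `v` will do.
  by_cases h0 : f + s • g = 0
  · obtain ⟨h, -, hh⟩ := exists_dual_apply_eq_zero_notMem_span hp.finrank_eq 0 g
    obtain ⟨w', s', hw', -, -, hface⟩ := key h
    refine ⟨w', ?_, hface fun e => hh ?_⟩
    · have e1 := LinearMap.congr_fun h0 (p w')
      have e2 := LinearMap.congr_fun h0 (p v)
      simp only [LinearMap.add_apply, LinearMap.smul_apply, smul_eq_mul,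
        LinearMap.zero_apply] at e1 e2
      nlinarith [hg w' hw']
    · rw [eq_neg_of_add_eq_zero_left e]
      exact Submodule.neg_mem _ (Submodule.smul_mem _ _ (Submodule.mem_span_singleton_self g))
  · refine ⟨w, ?_, h3 h0⟩
    nlinarith [hg w hw]

theorem exists_isFaceSet_pair (hp : IsSimplicialFamily p) (v : V) :
    ∃ w, w ≠ v ∧ IsFaceSet p {v, w} := by
  have := hp.finite_module
  obtain ⟨f, hf, -⟩ := exists_dual_ne_zero_apply_eq_zero hp.finrank_eq 0 0
  obtain ⟨w, hw⟩ := hp.exists_ne_apply hf v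
  have aux : ∀ f : Dual ℝ E, f (p v) < f (p w) → ∃ w, w ≠ v ∧ IsFaceSet p {v, w} := by
    intro f hf
    obtain ⟨u, hu, hface⟩ := hp.exists_improving f v ⟨w, hf⟩
    exact ⟨u, by rintro rfl; exact lt_irrefl _ hu, hface⟩
  rcases hw.lt_or_gt with h | h
  · exact aux (-f) (by simpa using h)
  · exact aux f h

/-- An edge lies in two triangles. -/
theorem exists_two_triangles (hp : IsSimplicialFamily p) {u v : V} (huv : IsFaceSet p {u, v}) :
    ∃ w₁ w₂, w₁ ≠ w₂ ∧ w₁ ∉ ({u, v} : Finset V) ∧ w₂ ∉ ({u, v} : Finset V) ∧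
      IsFaceSet p {u, v, w₁} ∧ IsFaceSet p {u, v, w₂} := by
  have := hp.finite_module
  obtain ⟨g, hg0, hg⟩ := huv
  have hu := (hg u).1 (by simp)
  have hv := (hg v).1 (by simp)
  have hguv : g (p v) = g (p u) := le_antisymm (hu v) (hv u)
  have hlt : ∀ w, w ∉ ({u, v} : Finset V) → g (p w) < g (p u) := by
    intro w hw
    rw [hg] at hw
    push Not at hw
    obtain ⟨w', hw'⟩ := hw
    exact hw'.trans_le (hu w')
  obtain ⟨w₀, hw₀⟩ := hp.exists_ne_apply hg0 u
  obtain ⟨h, hd, hspan⟩ := exists_dual_apply_eq_zero_notMem_span hp.finrank_eq (p v - p u) g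
  have key : ∀ f : Dual ℝ E, f (p v) = f (p u) → f ∉ Submodule.span ℝ {g} →
      ∃ w s, w ∉ ({u, v} : Finset V) ∧ f (p w) - f (p u) = s * (g (p u) - g (p w)) ∧
      (∀ w, f (p w) - f (p u) ≤ s * (g (p u) - g (p w))) ∧ IsFaceSet p {u, v, w} := by
    intro f hf hfs
    obtain ⟨w, s, h1, h2, h3⟩ := exists_max_slope (p := p) u g f ⟨w₀, lt_of_le_of_ne (hu w₀) hw₀⟩
    have hle : ∀ w, f (p w) - f (p u) ≤ s * (g (p u) - g (p w)) := by
      intro w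
      by_cases hw : w ∈ ({u, v} : Finset V)
      · rw [mem_insert, mem_singleton] at hw
        rcases hw with rfl | rfl
        · simp
        · simp [hf, hguv]
      · exact h3 w (hlt w hw)
    refine ⟨w, s, fun hw => ?_, h2, hle, ?_⟩
    · exact h1.not_ge ((hg w).1 hw u)
    · refine hp.isFaceSet_of_forall_le (l := f + s • g) (fun e => hfs ?_) (by simp) ?_
      · rw [eq_neg_of_add_eq_zero_left e]
        exact Submodule.neg_mem _ (Submodule.smul_mem _ _ (Submodule.mem_span_singleton_self g))
      · intro x hx y
        have := hle y
        simp only [LinearMap.add_apply, LinearMap.smul_apply, smul_eq_mul]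
        simp only [mem_insert, mem_singleton] at hx
        rcases hx with rfl | rfl | rfl
        · linarith
        · rw [hf, hguv]; linarith
        · linarith
  rw [map_sub, sub_eq_zero] at hd
  obtain ⟨w₁, s₁, m₁, e₁, le₁, face₁⟩ := key h hd hspan
  -- The plane is rotated about the edge in both directions. Hitting the same point twice would make
  -- `h + s₁ • g` constant on the family, hence zero.
  obtain ⟨w₂, s₂, m₂, e₂, le₂, face₂⟩ := key (-h) (by simp [hd]) (by simpa using hspan)
  refine ⟨w₁, w₂, ?_, m₁, m₂, face₁, face₂⟩
  rintro rfl
  have hpos := hlt w₁ m₁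
  simp only [LinearMap.neg_apply] at e₂ le₂
  have hs : s₂ = -s₁ := by
    have : (s₂ + s₁) * (g (p u) - g (p w₁)) = 0 := by linarith
    rcases mul_eq_zero.1 this with h | h
    · linarith
    · linarith
  have hconst : ∀ w, (h + s₁ • g) (p w) = (h + s₁ • g) (p u) := by
    intro w
    have a := le₁ w
    have b := le₂ w
    rw [hs] at b
    simp only [LinearMap.add_apply, LinearMap.smul_apply, smul_eq_mul]
    linarith
  have e := hp.spanning (h + s₁ • g) fun a b => (hconst a).trans (hconst b).symm
  refine hspan ?_
  rw [eq_neg_of_add_eq_zero_left e]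
  exact Submodule.neg_mem _ (Submodule.smul_mem _ _ (Submodule.mem_span_singleton_self g))

omit [Fintype V] in
/-- No edge lies in three triangles. -/
theorem not_three_triangles (hp : IsSimplicialFamily p) {u v : V} (huv : u ≠ v) (w : Fin 3 → V)
    (hw : Function.Injective w) (hwu : ∀ i, w i ∉ ({u, v} : Finset V)) :
    ¬ ∀ i, IsFaceSet p {u, v, w i} := by
  intro hface
  have := hp.finite_module
  choose l hl0 hl using hface
  have hmax : ∀ i x, x ∈ ({u, v, w i} : Finset V) → l i (p x) = l i (p u) := fun i x hx =>
    le_antisymm ((hl i u).1 (by simp) x) ((hl i x).1 hx u)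
  have hlt : ∀ i j, i ≠ j → l i (p (w j) - p u) < 0 := by
    intro i j hij
    have hn : w j ∉ ({u, v, w i} : Finset V) := by
      have := hwu j
      have := hw.ne hij.symm
      simp_all
    rw [hl] at hn
    push Not at hn
    obtain ⟨y, hy⟩ := hn
    rw [map_sub, sub_neg]
    exact hy.trans_le ((hl i u).1 (by simp) y)
  -- Four vectors in dimension three are dependent; every `l i` kills the edge direction, so the
  -- sign argument applies modulo it.
  have hdep : ¬ LinearIndependent ℝ ![p v - p u, p (w 0) - p u, p (w 1) - p u, p (w 2) - p u] := by
    intro h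
    have := h.fintype_card_le_finrank
    rw [hp.finrank_eq] at this
    simp at this
  rw [Fintype.not_linearIndependent_iff] at hdep
  obtain ⟨c, hc, i, hi⟩ := hdep
  simp only [Fin.sum_univ_four, Matrix.cons_val] at hc
  have h0 := eq_zero_of_sum_eq_of_neg l (fun i => p (w i) - p u) (-(c 0 • (p v - p u)))
    (fun i => by simp [hmax i v (by simp)]) (fun i => by simp [hmax i (w i) (by simp)]) hlt
    ![c 1, c 2, c 3] (by
      simp only [Fin.sum_univ_three, Matrix.cons_val]
      rw [eq_neg_iff_add_eq_zero, ← hc]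
      abel)
  have c1 : c 1 = 0 := congrFun h0 0
  have c2 : c 2 = 0 := congrFun h0 1
  have c3 : c 3 = 0 := congrFun h0 2
  simp only [c1, c2, c3, zero_smul, add_zero] at hc
  have c0 : c 0 = 0 :=
    (smul_eq_zero.1 hc).resolve_right (sub_ne_zero.2 (hp.injective.ne huv.symm))
  fin_cases i <;> simp_all

omit [Fintype V] in
/-- No point is strictly in the middle of three triangles, with respect to a functional. -/
theorem not_three_middle (hp : IsSimplicialFamily p) {v : V} {f : Dual ℝ E} (a b : Fin 3 → V)
    (ha : ∀ i, f (p (a i)) < f (p v)) (hb : ∀ i, f (p v) < f (p (b i)))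
    (hne : ∀ i j, i ≠ j → ({v, a i, b i} : Finset V) ≠ {v, a j, b j}) :
    ¬ ∀ i, IsFaceSet p {v, a i, b i} := by
  intro hface
  have := hp.finite_module
  choose l hl0 hl using hface
  have hle : ∀ i x, l i (p x - p v) ≤ 0 := fun i x => by
    rw [map_sub, sub_nonpos]
    exact (hl i v).1 (by simp) x
  have hiff : ∀ i x, x ∈ ({v, a i, b i} : Finset V) ↔ l i (p x - p v) = 0 := by
    intro i x
    refine ⟨fun hx => le_antisymm (hle i x) ?_, fun h => (hl i x).2 fun y => ?_⟩
    · rw [map_sub, sub_nonneg]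
      exact (hl i x).1 hx v
    · rw [map_sub, sub_eq_zero] at h
      rw [h]
      exact (hl i v).1 (by simp) y
  -- `r i` is the direction in which the level plane of `f` through `v` cuts the `i`-th triangle.
  -- The three directions lie in the at most two-dimensional kernel of `f`, so they are dependent.
  let r : Fin 3 → E := fun i =>
    (f (p (b i)) - f (p v)) • (p (a i) - p v) + (f (p v) - f (p (a i))) • (p (b i) - p v)
  have hrf : ∀ i, r i ∈ LinearMap.ker f := by
    intro i
    simp only [r, LinearMap.mem_ker, map_add, map_smul, map_sub, smul_eq_mul]
    ring
  have hr0 : ∀ i, l i (r i) = 0 := by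
    intro i
    simp only [r, map_add, map_smul, (hiff i (a i)).1 (by simp), (hiff i (b i)).1 (by simp),
      smul_zero, add_zero]
  have hneg : ∀ i j, i ≠ j → l i (r j) < 0 := by
    intro i j hij
    have p1 := sub_pos.2 (ha j)
    have p2 := sub_pos.2 (hb j)
    have q1 := hle i (a j)
    have q2 := hle i (b j)
    have hor : l i (p (a j) - p v) ≠ 0 ∨ l i (p (b j) - p v) ≠ 0 := by
      by_contra! hc
      rw [← hiff, ← hiff] at hc
      have hcard : ∀ i, #({v, a i, b i} : Finset V) = 3 := by
        intro i
        rw [card_eq_three]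
        refine ⟨v, a i, b i, ?_, ?_, ?_, rfl⟩
        · intro e
          exact (ha i).ne (by rw [← e])
        · intro e
          exact (hb i).ne (by rw [← e])
        · intro e
          exact ((ha i).trans (hb i)).ne (by rw [e])
      refine hne i j hij (eq_of_subset_of_card_le ?_ (by rw [hcard, hcard])).symm
      intro x hx
      simp only [mem_insert, mem_singleton] at hx
      rcases hx with rfl | rfl | rfl
      · simp
      · exact hc.1
      · exact hc.2
    simp only [r, map_add, map_smul, smul_eq_mul]
    rcases hor with h | h
    · have := mul_neg_of_pos_of_neg p2 (lt_of_le_of_ne q1 h)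
      have := mul_nonpos_of_nonneg_of_nonpos p1.le q2
      linarith
    · have := mul_neg_of_pos_of_neg p1 (lt_of_le_of_ne q2 h)
      have := mul_nonpos_of_nonneg_of_nonpos p2.le q1
      linarith
  have hker : finrank ℝ (LinearMap.ker f) < 3 := by
    rw [← hp.finrank_eq]
    refine Submodule.finrank_lt fun e => ?_
    rw [LinearMap.ker_eq_top] at e
    have := ha 0
    simp [e] at this
  have hdep : ¬ LinearIndependent ℝ (fun i => (⟨r i, hrf i⟩ : LinearMap.ker f)) := by
    intro h
    have := h.fintype_card_le_finrank
    rw [Fintype.card_fin] at this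
    omega
  rw [Fintype.not_linearIndependent_iff] at hdep
  obtain ⟨c, hc, i, hi⟩ := hdep
  have hc' : ∑ i, c i • r i = 0 := by
    simpa using congrArg (Submodule.subtype _) hc
  exact hi (congrFun (eq_zero_of_sum_eq_of_neg l r 0 (by simp) hr0 hneg c hc') i)

/-- Balinski's theorem for the removal of two vertices. -/
theorem exists_cross (hp : IsSimplicialFamily p) (X : Set V) (a b : V)
    (hX : ∃ x ∈ X, x ≠ a ∧ x ≠ b) (hY : ∃ y ∈ Xᶜ, y ≠ a ∧ y ≠ b) :
    ∃ x ∈ X, ∃ y ∈ Xᶜ, IsFaceSet p {x, y} ∧ x ≠ a ∧ x ≠ b ∧ y ≠ a ∧ y ≠ b := by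
  have := hp.finite_module
  by_contra! hc
  obtain ⟨x, hx, hxa, hxb⟩ := hX
  obtain ⟨y, hy, hya, hyb⟩ := hY
  -- `l` takes the same value at `a`, `b` and `x`.
  obtain ⟨l, hl0, h1, h2⟩ :=
    exists_dual_ne_zero_apply_eq_zero hp.finrank_eq (p a - p x) (p b - p x)
  rw [map_sub, sub_eq_zero] at h1 h2
  have hcross : ∀ x ∈ X, ∀ y ∈ Xᶜ, x ≠ a → x ≠ b → y ≠ a → y ≠ b → ¬ IsFaceSet p {x, y} := by
    intro x hx y hy h1 h2 h3 h4 h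
    exact h4 (hc x hx y hy h h1 h2 h3)
  -- Climbing from level `f (p x)` or above never meets `a` or `b`, and without crossing edges it
  -- stays in `Z`; so it ends at a maximizer in `Z`.
  have climb : ∀ f : Dual ℝ E, f ≠ 0 → f (p a) = f (p x) → f (p b) = f (p x) →
      ∀ w, f (p x) < f (p w) → ∀ Z : Set V, (∀ u ∈ Z, ∀ w ∉ Z, u ≠ a → u ≠ b → w ≠ a → w ≠ b →
      ¬ IsFaceSet p {u, w}) → (∃ z ∈ Z, z ≠ a ∧ z ≠ b ∧ f (p x) ≤ f (p z)) →
      ∃ z ∈ Z, z ≠ a ∧ z ≠ b ∧ ∀ w, f (p w) ≤ f (p z) := by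
    intro f hf0 hfa hfb t ht Z hZ hne
    classical
    obtain ⟨z, hz, hzmax⟩ := exists_max_image
      ({z | z ∈ Z ∧ z ≠ a ∧ z ≠ b ∧ f (p x) ≤ f (p z)} : Finset V) (fun z => f (p z)) (by
        obtain ⟨z, hz⟩ := hne
        exact ⟨z, by simpa using hz⟩)
    simp only [mem_filter, mem_univ, true_and] at hz hzmax
    obtain ⟨hzZ, hza, hzb, hzx⟩ := hz
    refine ⟨z, hzZ, hza, hzb, ?_⟩
    by_contra! hw
    obtain ⟨w, hw, hface⟩ := hp.exists_improving f z hw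
    have hwa : w ≠ a := by rintro rfl; linarith
    have hwb : w ≠ b := by rintro rfl; linarith
    by_cases hwZ : w ∈ Z
    · exact (hzmax w ⟨hwZ, hwa, hwb, hzx.trans hw.le⟩).not_gt hw
    · exact hZ z hzZ w hwZ hza hzb hwa hwb hface
  -- Otherwise both sides contain maximizers of `f` other than `a` and `b`; these lie on one face,
  -- so they span a crossing edge.
  have same : ∀ f : Dual ℝ E, f ≠ 0 → f (p a) = f (p x) → f (p b) = f (p x) →
      ∀ w, f (p x) < f (p w) → ¬ f (p x) ≤ f (p y) := by
    intro f hf0 hfa hfb w hw hxy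
    obtain ⟨z, hz, hza, hzb, hzm⟩ := climb f hf0 hfa hfb w hw X hcross ⟨x, hx, hxa, hxb, le_rfl⟩
    obtain ⟨z', hz', hza', hzb', hzm'⟩ := climb f hf0 hfa hfb w hw Xᶜ
      (fun u hu w hw h1 h2 h3 h4 h => hcross w (not_not.1 hw) u hu h3 h4 h1 h2
        (by rwa [pair_comm])) ⟨y, hy, hya, hyb, hxy⟩
    refine hcross z hz z' hz' hza hzb hza' hzb'
      (hp.isFaceSet_of_forall_le hf0 (by simp) fun u hu => ?_)
    rw [mem_insert, mem_singleton] at hu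
    rcases hu with rfl | rfl
    exacts [hzm, hzm']
  have sameneg : ∀ w, l (p w) < l (p x) → ¬ l (p y) ≤ l (p x) := by
    intro w hw h
    exact same (-l) (by simpa using hl0) (by simp [h1]) (by simp [h2]) w (by simpa using hw)
      (by simpa using h)
  -- A point `w` off the level of `x` forces `y` strictly to the opposite side, where `y` itself
  -- then plays the role of `w` for the opposite functional.
  obtain ⟨w, hw⟩ := hp.exists_ne_apply hl0 x
  rcases hw.lt_or_gt with h | h
  · have := not_le.1 (sameneg w h)
    exact same l hl0 h1 h2 y this this.le
  · have := not_le.1 (same l hl0 h1 h2 w h)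
    exact sameneg y this this.le

end IsSimplicialFamily

/-! ### The triangles form a facet family. -/

namespace IsSimplicialFamily

variable {V E : Type*} [Fintype V] [DecidableEq V] [AddCommGroup E] [Module ℝ E] {p : V → E}

omit [Fintype V] in
theorem exists_middle {f : Dual ℝ E}
    (hf : ∀ v w, v ≠ w → f (p v) ≠ f (p w)) {A : Finset V} (hA : #A = 3) :
    ∃ v a b, A = {v, a, b} ∧ f (p a) < f (p v) ∧ f (p v) < f (p b) := by
  have hinj : Set.InjOn (fun v => f (p v)) (A : Set V) := by
    intro v _ w _ h
    by_contra hne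
    exact hf v w hne h
  obtain ⟨a, ha, hamin⟩ := exists_min_image A (fun v => f (p v)) (card_pos.1 (by omega))
  obtain ⟨b, hb, hbmax⟩ := exists_max_image A (fun v => f (p v)) (card_pos.1 (by omega))
  obtain ⟨v, hv⟩ : ∃ v, v ∈ (A.erase a).erase b := by
    rw [← Finset.Nonempty, ← card_pos]
    have := pred_card_le_card_erase (s := A.erase a) (a := b)
    rw [card_erase_of_mem ha] at this
    omega
  simp only [mem_erase] at hv
  have h1 := (hamin v hv.2.2).lt_of_ne (hf _ _ hv.2.1.symm)
  have h2 := (hbmax v hv.2.2).lt_of_ne (hf _ _ hv.1)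
  refine ⟨v, a, b, (eq_of_subset_of_card_le ?_ ?_).symm, h1, h2⟩
  · intro x hx
    simp only [mem_insert, mem_singleton] at hx
    rcases hx with rfl | rfl | rfl
    exacts [hv.2.2, ha, hb]
  · rw [hA, card_insert_of_notMem, card_insert_of_notMem, card_singleton]
    · rw [mem_singleton]
      rintro rfl
      exact (h1.trans h2).ne rfl
    · simpa using hv.symm.imp_left fun h => h.1

open Classical in
theorem isFacetFamily (hp : IsSimplicialFamily p) {G : SimpleGraph V}
    (hG : ∀ u v, G.Adj u v ↔ u ≠ v ∧ IsFaceSet p {u, v}) :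
    IsFacetFamily G ({A | #A = 3 ∧ IsFaceSet p A} : Finset (Finset V)) where
  card_eq A hA := (mem_filter.1 hA).2.1
  adj A hA u hu v hv huv := by
    refine (hG u v).2 ⟨huv, hp.isFaceSet_subset (mem_filter.1 hA).2.2 ?_ (by simp)⟩
    intro x hx
    rw [mem_insert, mem_singleton] at hx
    rcases hx with rfl | rfl
    exacts [hu, hv]
  card_edge u v huv := by
    rw [hG] at huv
    obtain ⟨huv, hface⟩ := huv
    have card : ∀ w, w ∉ ({u, v} : Finset V) → #({u, v, w} : Finset V) = 3 := by
      intro w hw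
      simp only [mem_insert, mem_singleton, not_or] at hw
      exact card_eq_three.2 ⟨u, v, w, huv, Ne.symm hw.1, Ne.symm hw.2, rfl⟩
    have third : ∀ A : Finset V, #A = 3 → u ∈ A → v ∈ A →
        ∃ w, w ∉ ({u, v} : Finset V) ∧ A = {u, v, w} := by
      intro A hA hu hv
      obtain ⟨w, hwA, hw⟩ := exists_mem_notMem_of_card_lt_card (s := {u, v}) (t := A)
        (by rw [card_pair huv]; omega)
      refine ⟨w, hw, (eq_of_subset_of_card_le ?_ (by rw [hA, card w hw])).symm⟩
      intro x hx
      simp only [mem_insert, mem_singleton] at hx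
      rcases hx with rfl | rfl | rfl
      exacts [hu, hv, hwA]
    refine le_antisymm ?_ ?_
    · by_contra! hc
      obtain ⟨A, B, C, hA, hB, hC, hAB, hAC, hBC⟩ := two_lt_card_iff.1 hc
      simp only [mem_filter, mem_univ, true_and] at hA hB hC
      obtain ⟨a, ha, rfl⟩ := third A hA.1.1 hA.2.1 hA.2.2
      obtain ⟨b, hb, rfl⟩ := third B hB.1.1 hB.2.1 hB.2.2
      obtain ⟨c, hc, rfl⟩ := third C hC.1.1 hC.2.1 hC.2.2
      have hab : a ≠ b := by rintro rfl; exact hAB rfl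
      have hac : a ≠ c := by rintro rfl; exact hAC rfl
      have hbc : b ≠ c := by rintro rfl; exact hBC rfl
      refine hp.not_three_triangles huv ![a, b, c] ?_ ?_ ?_
      · intro i j
        fin_cases i <;> fin_cases j <;> simp [hab, hac, hbc, hab.symm, hac.symm, hbc.symm]
      · intro i
        fin_cases i
        exacts [ha, hb, hc]
      · intro i
        fin_cases i
        exacts [hA.1.2, hB.1.2, hC.1.2]
    · obtain ⟨w₁, w₂, hne, m₁, m₂, f₁, f₂⟩ := hp.exists_two_triangles hface
      refine one_lt_card.2 ⟨{u, v, w₁}, ?_, {u, v, w₂}, ?_, ?_⟩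
      · simpa using ⟨card w₁ m₁, f₁⟩
      · simpa using ⟨card w₂ m₂, f₂⟩
      · intro e
        have : w₁ ∈ ({u, v, w₂} : Finset V) := by rw [← e]; simp
        simp_all
  card_lt := by
    have := hp.finite_module
    -- A generic `f` separates all vertices. Each vertex is the middle of at most two triangles and
    -- the lowest of none, so there are at most `2(n - 1)`.
    obtain ⟨f, hf⟩ := exists_dual_forall_apply_ne_zero (K := ℝ)
      (fun q : {q : V × V // q.1 ≠ q.2} => p q.1.1 - p q.1.2)
      (fun q => sub_ne_zero.2 (hp.injective.ne q.2))
    have hf' : ∀ v w, v ≠ w → f (p v) ≠ f (p w) := fun v w h => by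
      simpa [sub_eq_zero] using hf ⟨(v, w), h⟩
    have hV : Nonempty V := by
      by_contra hV
      rw [not_nonempty_iff] at hV
      obtain ⟨l, hl, -⟩ := exists_dual_ne_zero_apply_eq_zero hp.finrank_eq 0 0
      exact hl (hp.spanning l isEmptyElim)
    obtain ⟨v₀, -, hv₀⟩ := exists_min_image univ (fun v => f (p v)) univ_nonempty
    -- For sets that are not triples `v₀` is a dummy value.
    have hmid : ∀ A : Finset V, ∃ v, #A = 3 →
        ∃ a b, A = {v, a, b} ∧ f (p a) < f (p v) ∧ f (p v) < f (p b) := by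
      intro A
      by_cases hA : #A = 3
      · obtain ⟨v, h⟩ := exists_middle hf' hA
        exact ⟨v, fun _ => h⟩
      · exact ⟨v₀, fun h => absurd h hA⟩
    choose mid hmid using hmid
    have hle := card_le_mul_card_image_of_maps_to (f := mid) (t := univ.erase v₀) (n := 2)
      (s := ({A | #A = 3 ∧ IsFaceSet p A} : Finset (Finset V))) ?_ ?_
    · rw [card_erase_of_mem (mem_univ _), card_univ] at hle
      have : 0 < Fintype.card V := Fintype.card_pos
      omega
    · intro A hA
      obtain ⟨a, b, -, h, -⟩ := hmid A (mem_filter.1 hA).2.1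
      refine mem_erase.2 ⟨?_, mem_univ _⟩
      intro e
      rw [e] at h
      exact (hv₀ a (mem_univ _)).not_gt h
    · intro v _
      by_contra! hc
      obtain ⟨A, B, C, hA, hB, hC, hAB, hAC, hBC⟩ := two_lt_card_iff.1 hc
      simp only [mem_filter, mem_univ, true_and] at hA hB hC
      obtain ⟨a₁, b₁, e₁, l₁, u₁⟩ := hmid A hA.1.1
      obtain ⟨a₂, b₂, e₂, l₂, u₂⟩ := hmid B hB.1.1
      obtain ⟨a₃, b₃, e₃, l₃, u₃⟩ := hmid C hC.1.1
      rw [hA.2] at e₁ l₁ u₁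
      rw [hB.2] at e₂ l₂ u₂
      rw [hC.2] at e₃ l₃ u₃
      refine hp.not_three_middle (v := v) (f := f) ![a₁, a₂, a₃] ![b₁, b₂, b₃] ?_ ?_ ?_ ?_
      · intro i
        fin_cases i
        exacts [l₁, l₂, l₃]
      · intro i
        fin_cases i
        exacts [u₁, u₂, u₃]
      · rw [e₁, e₂] at hAB
        rw [e₁, e₃] at hAC
        rw [e₂, e₃] at hBC
        intro i j hij
        fin_cases i <;> fin_cases j
        exacts [absurd rfl hij, hAB, hAC, hAB.symm, absurd rfl hij, hBC, hAC.symm, hBC.symm,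
          absurd rfl hij]
      · intro i
        fin_cases i
        exacts [e₁ ▸ hA.1.2, e₂ ▸ hB.1.2, e₃ ▸ hC.1.2]
  exists_neighbor v := by
    obtain ⟨w, hw, hface⟩ := hp.exists_isFaceSet_pair v
    exact ⟨w, (hG v w).2 ⟨hw.symm, hface⟩⟩
  exists_cross X a b hX hY := by
    obtain ⟨x, hx, y, hy, hface, h⟩ := hp.exists_cross X a b hX hY
    exact ⟨x, hx, y, hy, (hG x y).2 ⟨fun e => hy (e ▸ hx), hface⟩, h⟩

end IsSimplicialFamily

end

section

open Module

/-! ### Faces and vertices of convex hulls of finite sets. -/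

section Convex

variable {E : Type*} [NormedAddCommGroup E] [NormedSpace ℝ E] {S P : Set E}

/-- An extreme point `x` is outside the compact hull of `S \ {x}`. A functional separating them
strictly exposes `x`, because every point of the polytope lies on a segment from `x` to that hull.
-/
theorem extremePoints_subset_exposedPoints_of_finite (hS : S.Finite) :
    (convexHull ℝ S).extremePoints ℝ ⊆ (convexHull ℝ S).exposedPoints ℝ := by
  intro x hx
  have hxS := extremePoints_convexHull_subset hx
  have hfin : (S \ {x}).Finite := hS.subset Set.sdiff_subset
  have hxn : x ∉ convexHull ℝ (S \ {x}) := fun h =>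
    (extremePoints_convexHull_subset (inter_extremePoints_subset_extremePoints_of_subset
      (convexHull_mono Set.sdiff_subset) ⟨h, hx⟩)).2 rfl
  obtain ⟨l, c, hlt, hlx⟩ := geometric_hahn_banach_closed_point (convex_convexHull ℝ _)
    (hfin.isCompact_convexHull (𝕜 := ℝ)).isClosed hxn
  refine ⟨hx.1, l, fun y hy => ?_⟩
  rcases (S \ {x}).eq_empty_or_nonempty with he | hne
  · have : S = {x} := by
      refine Set.eq_singleton_iff_unique_mem.2 ⟨hxS, fun z hz => ?_⟩
      by_contra hzx
      exact Set.notMem_empty z (he ▸ ⟨hz, hzx⟩)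
    rw [this, convexHull_singleton] at hy
    obtain rfl := hy
    exact ⟨le_rfl, fun _ => rfl⟩
  · rw [← Set.insert_sdiff_self_of_mem hxS, convexHull_insert hne, mem_convexJoin] at hy
    obtain ⟨x', rfl, z, hz, a, b, ha, hb, hab, rfl⟩ := hy
    have hlz := (hlt z hz).trans hlx
    obtain rfl : a = 1 - b := by linarith
    simp only [map_add, map_smul, smul_eq_mul]
    have := mul_nonneg hb (sub_nonneg.2 hlz.le)
    refine ⟨by linarith, fun h => ?_⟩
    have h0 : b * (l x' - l z) = 0 := by linarith
    obtain rfl := (mul_eq_zero.1 h0).resolve_right (sub_pos.2 hlz).ne'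
    simp

theorem exposedPoints_finite_of_finite (hS : S.Finite) :
    ((convexHull ℝ S).exposedPoints ℝ).Finite :=
  hS.subset (exposedPoints_subset_extremePoints.trans extremePoints_convexHull_subset)

/-- A face of a polytope is the convex hull of the vertices it contains. -/
theorem toExposed_subset_convexHull (hS : S.Finite) (l : StrongDual ℝ E) :
    l.toExposed (convexHull ℝ S) ⊆
      convexHull ℝ ((convexHull ℝ S).exposedPoints ℝ ∩ l.toExposed (convexHull ℝ S)) := by
  have hexp : IsExposed ℝ (convexHull ℝ S) (l.toExposed (convexHull ℝ S)) :=
    ContinuousLinearMap.toExposed.isExposed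
  have hsub : (l.toExposed (convexHull ℝ S)).extremePoints ℝ ⊆
      (convexHull ℝ S).exposedPoints ℝ ∩ l.toExposed (convexHull ℝ S) := fun x hx =>
    ⟨extremePoints_subset_exposedPoints_of_finite hS
      (hexp.isExtreme.extremePoints_subset_extremePoints hx), hx.1⟩
  have hfin : ((convexHull ℝ S).exposedPoints ℝ ∩ l.toExposed (convexHull ℝ S)).Finite :=
    (exposedPoints_finite_of_finite hS).subset Set.inter_subset_left
  -- Krein–Milman for the face; the closure is harmless since the hull of finitely many points is
  -- closed.
  conv_lhs => rw [← closure_convexHull_extremePoints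
    (hexp.isCompact (hS.isCompact_convexHull (𝕜 := ℝ))) (hexp.convex (convex_convexHull ℝ S))]
  exact closure_minimal (convexHull_mono hsub) (hfin.isCompact_convexHull (𝕜 := ℝ)).isClosed

theorem convexHull_exposedPoints_of_finite (hS : S.Finite) :
    convexHull ℝ ((convexHull ℝ S).exposedPoints ℝ) = convexHull ℝ S := by
  refine (convexHull_min exposedPoints_subset (convex_convexHull ℝ S)).antisymm fun x hx => ?_
  exact convexHull_mono Set.inter_subset_left (toExposed_subset_convexHull hS 0 ⟨hx, by simp⟩)

end Convex

/-! ### From simplicial polytopes to simplicial families. -/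

namespace Polytope

variable {P : Set R3}

theorem Is3Polytope.le_of_forall_exposedPoints_le (hP : Is3Polytope P) (l : StrongDual ℝ R3) {c : ℝ}
    (h : ∀ x ∈ P.exposedPoints ℝ, l x ≤ c) : ∀ x ∈ P, l x ≤ c := by
  obtain ⟨⟨S, hS, rfl⟩, -⟩ := hP
  intro x hx
  rw [← convexHull_exposedPoints_of_finite hS] at hx
  exact convexHull_min h (convex_halfSpace_le l.isLinear c) hx

/-- Such an `l` is constant on `P`, so it vanishes on the direction of its affine hull, which is the
whole space. -/
theorem Is3Polytope.eq_zero_of_const (hP : Is3Polytope P) (l : StrongDual ℝ R3) {c : ℝ}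
    (h : ∀ x ∈ P.exposedPoints ℝ, l x = c) : l = 0 := by
  have hle := hP.le_of_forall_exposedPoints_le l fun x hx => (h x hx).le
  have hge := hP.le_of_forall_exposedPoints_le (-l) (c := -c) fun x hx => by simp [h x hx]
  have hc : ∀ x ∈ P, l x = c := fun x hx =>
    (hle x hx).antisymm (by simpa using hge x hx)
  have htop : (affineSpan ℝ P).direction = ⊤ :=
    Submodule.eq_top_of_finrank_eq (hP.2.trans (by simp))
  have hker : (affineSpan ℝ P).direction ≤ LinearMap.ker (l : R3 →ₗ[ℝ] ℝ) := by
    rw [direction_affineSpan, vectorSpan_def, Submodule.span_le]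
    rintro _ ⟨x, hx, y, hy, rfl⟩
    simp [hc x hx, hc y hy]
  ext x
  have : x ∈ (affineSpan ℝ P).direction := htop ▸ Submodule.mem_top
  simpa using hker this

theorem exists_strongDual (l : Dual ℝ R3) : ∃ l' : StrongDual ℝ R3, (l' : R3 →ₗ[ℝ] ℝ) = l :=
  ⟨LinearMap.toContinuousLinearMap l, LinearMap.coe_toContinuousLinearMap l⟩

theorem Is3Polytope.mem_toExposed (hP : Is3Polytope P) {V : Type*} (e : V ≃ P.exposedPoints ℝ)
    (l : StrongDual ℝ R3) {v : V} (h : ∀ w, l (e w) ≤ l (e v)) : (e v : R3) ∈ l.toExposed P :=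
  ⟨exposedPoints_subset (e v).2, hP.le_of_forall_exposedPoints_le l fun x hx => by
    simpa using h (e.symm ⟨x, hx⟩)⟩

theorem Is3Polytope.toExposed_ne (hP : Is3Polytope P) {V : Type*} (e : V ≃ P.exposedPoints ℝ)
    {l : StrongDual ℝ R3} (hl : l ≠ 0) (v : V) : l.toExposed P ≠ P := by
  intro h
  have hall : ∀ x ∈ P, ∀ y ∈ P, l y ≤ l x := fun x hx => by
    rw [← h] at hx
    exact hx.2
  exact hl (hP.eq_zero_of_const l (c := l (e v)) fun x hx =>
    (hall _ (exposedPoints_subset (e v).2) x (exposedPoints_subset hx)).antisymm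
      (hall x (exposedPoints_subset hx) _ (exposedPoints_subset (e v).2)))

/-- Vertices of `P` on a face are extreme points of that face, a simplex, and so belong to the
affinely independent set spanning it. -/
theorem IsSimplicial3Polytope.affineIndependent (hP : IsSimplicial3Polytope P) {V : Type*}
    (e : V ≃ P.exposedPoints ℝ) {l : StrongDual ℝ R3} (hl : l ≠ 0) :
    AffineIndependent ℝ (fun v : {v // ∀ w, l (e w) ≤ l (e v)} => (e v : R3)) := by
  rcases isEmpty_or_nonempty {v // ∀ w, l (e w) ≤ l (e v)} with hV | ⟨⟨v₀, hv₀⟩⟩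
  · exact affineIndependent_of_subsingleton ℝ _
  have hproper : IsProperFace P (l.toExposed P) :=
    ⟨ContinuousLinearMap.toExposed.isExposed, ⟨_, hP.1.mem_toExposed e l hv₀⟩,
      hP.1.toExposed_ne e hl v₀⟩
  obtain ⟨T, hT, hF⟩ := hP.2 _ hproper
  have hmemT : ∀ v : {v // ∀ w, l (e w) ≤ l (e v)}, (e v.1 : R3) ∈ T := by
    intro v
    refine Finset.mem_coe.1 (extremePoints_convexHull_subset (𝕜 := ℝ) ?_)
    rw [← hF]
    exact inter_extremePoints_subset_extremePoints_of_subset hproper.1.subset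
      ⟨hP.1.mem_toExposed e l v.2, exposedPoints_subset_extremePoints (e v.1).2⟩
  let ι : {v // ∀ w, l (e w) ≤ l (e v)} ↪ T := ⟨fun v => ⟨e v.1, hmemT v⟩, fun v w h =>
    Subtype.ext (e.injective (Subtype.ext (congrArg (fun t : T => (t : R3)) h)))⟩
  exact hT.comp_embedding ι

theorem isSimplicialFamily (hP : IsSimplicial3Polytope P) {V : Type*} (e : V ≃ P.exposedPoints ℝ) :
    IsSimplicialFamily fun v => (e v : R3) where
  finrank_eq := by simp
  exposed v := by
    obtain ⟨-, l, hl⟩ := (e v).2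
    refine ⟨l, fun w hw => ?_⟩
    have hw' := hl _ (exposedPoints_subset (e w).2)
    refine lt_of_not_ge fun h => hw (e.injective (Subtype.ext (hw'.2 h)))
  spanning l hl := by
    rcases isEmpty_or_nonempty V with hV | ⟨⟨v₀⟩⟩
    · have := hP.1.eq_zero_of_const (LinearMap.toContinuousLinearMap l) (c := 0) fun x hx =>
        isEmptyElim (e.symm ⟨x, hx⟩)
      simpa using this
    · have := hP.1.eq_zero_of_const (LinearMap.toContinuousLinearMap l) (c := l (e v₀))
        fun x hx => by simpa using hl (e.symm ⟨x, hx⟩) v₀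
      simpa using this
  indep l hl := by
    obtain ⟨l, rfl⟩ := exists_strongDual l
    exact hP.affineIndependent e fun h => hl (by rw [h]; rfl)

/-- Translates edges into a condition on vertices alone: a face is the hull of its vertices, and
conversely a vertex of `P` on the segment is extreme there, hence an endpoint. -/
theorem isFaceSet_pair_iff (hP : IsSimplicial3Polytope P) {V : Type*} [DecidableEq V]
    (e : V ≃ P.exposedPoints ℝ) (u v : V) :
    IsFaceSet (fun v => (e v : R3)) {u, v} ↔ IsProperFace P (segment ℝ (e u : R3) (e v)) := by
  constructor
  · rintro ⟨l, hl0, hl⟩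
    obtain ⟨l, rfl⟩ := exists_strongDual l
    have hu := hP.1.mem_toExposed e l ((hl u).1 (by simp))
    have hv := hP.1.mem_toExposed e l ((hl v).1 (by simp))
    have hexp : IsExposed ℝ P (l.toExposed P) := ContinuousLinearMap.toExposed.isExposed
    have hconv : Convex ℝ P := by
      obtain ⟨⟨S, -, rfl⟩, -⟩ := hP.1
      exact convex_convexHull ℝ S
    have heq : segment ℝ (e u : R3) (e v) = l.toExposed P := by
      refine ((hexp.convex hconv).segment_subset hu hv).antisymm ?_
      have : l.toExposed P ⊆ convexHull ℝ (P.exposedPoints ℝ ∩ l.toExposed P) := by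
        obtain ⟨⟨S, hS, rfl⟩, -⟩ := hP.1
        exact toExposed_subset_convexHull hS l
      rw [← convexHull_pair]
      refine this.trans (convexHull_mono ?_)
      rintro x ⟨hx, hx'⟩
      have hxuv : e.symm ⟨x, hx⟩ ∈ ({u, v} : Finset V) := by
        rw [hl]
        intro w
        simpa using hx'.2 _ (exposedPoints_subset (e w).2)
      rw [Finset.mem_insert, Finset.mem_singleton, Equiv.symm_apply_eq, Equiv.symm_apply_eq] at hxuv
      rcases hxuv with h | h
      · exact Or.inl (congrArg Subtype.val h)
      · exact Or.inr (congrArg Subtype.val h)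
    rw [heq]
    exact ⟨hexp, ⟨_, hu⟩, hP.1.toExposed_ne e (fun h => hl0 (by rw [h]; rfl)) u⟩
  · rintro ⟨hexp, hne, hproper⟩
    obtain ⟨l, hl⟩ := hexp hne
    refine ⟨l, fun h => hproper ?_, fun w => ?_⟩
    · have : l = 0 := by
        ext x
        exact LinearMap.congr_fun h x
      rw [hl, this]
      simp
    · have hw : (∀ y ∈ P, l y ≤ l (e w)) ↔ ∀ y, l (e y) ≤ l (e w) :=
        ⟨fun h y => h _ (exposedPoints_subset (e y).2), fun h =>
          hP.1.le_of_forall_exposedPoints_le l fun x hx => by simpa using h (e.symm ⟨x, hx⟩)⟩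
      have hw' : (e w : R3) ∈ segment ℝ (e u : R3) (e v) ↔ ∀ y, l (e y) ≤ l (e w) := by
        rw [hl, ← hw]
        exact ⟨fun h => h.2, fun h => ⟨exposedPoints_subset (e w).2, h⟩⟩
      refine Iff.trans ?_ hw'
      rw [Finset.mem_insert, Finset.mem_singleton]
      constructor
      · rintro (rfl | rfl)
        · exact left_mem_segment ℝ _ _
        · exact right_mem_segment ℝ _ _
      · intro h
        have hext := inter_extremePoints_subset_extremePoints_of_subset hexp.subset
          ⟨h, exposedPoints_subset_extremePoints (e w).2⟩
        rw [← convexHull_pair] at hext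
        rcases extremePoints_convexHull_subset hext with h | h
        · exact Or.inl (e.injective (Subtype.ext h))
        · exact Or.inr (e.injective (Subtype.ext h))

end Polytope

end

/-! ### Conclusion for plane triangulations. -/

theorem IsPlaneTriangulation.exists_isFacetFamily {V : Type*} [Fintype V] [DecidableEq V]
    {G : SimpleGraph V} (hG : IsPlaneTriangulation G) : ∃ T, IsFacetFamily G T := by
  obtain ⟨P, hP, ⟨φ⟩⟩ := hG
  refine ⟨_, (Polytope.isSimplicialFamily hP φ.toEquiv).isFacetFamily fun u v => ?_⟩
  rw [Polytope.isFaceSet_pair_iff hP, ← φ.map_adj_iff]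
  exact and_congr_left fun _ => φ.injective.ne_iff

theorem theorem2p1 {V : Type*} [Fintype V] (G : SimpleGraph V) [DecidableRel G.Adj]
    (hG : IsPlaneTriangulation G) :
    (∀ C : Set (Sym2 V), EdgeCut.IsMinimum G C → ¬ EdgeCut.IsTrivial G C → 6 ≤ C.ncard) ∧
    (∀ X : Set V, 3 ≤ X.ncard → 3 ≤ Xᶜ.ncard → 6 ≤ (EdgeCut.cut G X).ncard) ∧
    G.minDegree ≤ 5 ∧
    (∀ C : Set (Sym2 V), EdgeCut.IsMinimum G C → EdgeCut.IsTrivial G C) := by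
  classical
  obtain ⟨T, hT⟩ := hG.exists_isFacetFamily
  exact ⟨fun C hC hn => absurd (hT.isTrivial_of_isMinimum hC) hn, hT.six_le_ncard_cut,
    hT.minDegree_le_five, fun C hC => hT.isTrivial_of_isMinimum hC⟩
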